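/- For $a,d,u,v\in\mathbb{R}$ write $g(u;a)=u(1-u)(u-a)$, let $g'(u;a)$ denote the derivative with respect to $u$, and put $$G(u,v;a,d)=\bigl(2d(v-u)+g(u;a),\; 2d(u-v)+g(v;a)\bigr)\in\mathbb{R}^2 .$$ There exist two continuous functions $d_\pm:[0,1]\to[0,\infty)$ with the following properties. (i) For every $0<a<1$ we have $d_+(a)=\tfrac14 g'(a;a)$, $d_-(a)=d_-(1-a)$, $d_+(a)=d_+(1-a)$ and $d_-(a)<d_+(a)$. In addition $d_-(0)=d_+(0)=d_-(1)=d_+(1)=0$ and $d_-(\tfrac12)=\tfrac1{24}$. (ii) $d_-\in C^\infty([0,\tfrac12))\cap C^\infty((\tfrac12,1])$, and $d_-$ is strictly increasing on $[0,\tfrac12]$ and strictly decreasing on $[\tfrac12,1]$. (iii) For every $0<a<1$ the equation $G(u,v;a,d)=0$ has exactly nine distinct roots $(u,v)\in\mathbb{R}^2$ if $0\le d<d_-(a)$, exactly five if $d_-(a)<d<d_+(a)$, and exactly three if $d\ge d_+(a)$. (iv) For every $0<a<1$ the equation $G(u,v;a,d_-(a))=0$ has exactly seven distinct roots $(u,v)\in\mathbb{R}^2$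 if $a\ne\tfrac12$, and exactly five if $a=\tfrac12$. (v) We have $d_-(a)=\tfrac18a^2+\tfrac1{32}a^4+O(a^5)$ as $a\downarrow0$. Moreover $d_-$ maps $[0,\tfrac12]$ bijectively onto $[0,\tfrac1{24}]$, and its inverse $a_-:[0,\tfrac1{24}]\to[0,\tfrac12]$ satisfies $$a_-(d)=\tfrac12-\sqrt{-1152\,(d-\tfrac1{24})^3}+O\bigl((d-\tfrac1{24})^2\bigr)\qquad\text{as } d\uparrow\tfrac1{24}.$$ -/

import Mathlib

open Set Filter Topology Asymptotics
open scoped ContDiff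

/-- The bistable cubic `g(u; a) = u (1 - u) (u - a)`. -/
def nagumoG (u a : ℝ) : ℝ := u * (1 - u) * (u - a)

/-- The planar map
`G(u, v; a, d) = (2 d (v - u) + g(u; a), 2 d (u - v) + g(v; a))`. -/
def bichromaticG (u v a d : ℝ) : ℝ × ℝ :=
  (2 * d * (v - u) + nagumoG u a, 2 * d * (u - v) + nagumoG v a)

/-- The set of all real roots `(u, v)` of `G(u, v; a, d) = 0`. -/
def bichromaticRoots (a d : ℝ) : Set (ℝ × ℝ) :=
  {p | bichromaticG p.1 p.2 a d = 0}

/-!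
Off the diagonal, subtracting the two equations allows division by `v - u`, and in the variables
`t = u + v - 2 (1 + a) / 3` and `(u - v) ^ 2` the system becomes triangular
(`mem_bichromaticRoots_iff`): the depressed cubic `t ^ 3 - E t + B = 0`, whose coefficient `E` is
affine in `d` and whose coefficient `B` depends on `a` only, together with
`(u - v) ^ 2 = 4 E + 8 d - 3 t ^ 2`. So the number of roots is three (the diagonal ones) plus two
for each real root `t` of the cubic that makes the right-hand side of the last equation positive.

That right-hand side vanishes only if an off-diagonal root merges with a diagonal root `(u, u)`,
which requires `4 d = g'(u; a)` with `u ∈ {0, a, 1}`; this produces the factorization behind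
`branchSq_pos` and `branchSq_nonpos`: all real roots `t` are admissible when `d < d₊(a)`, none when
`d ≥ d₊(a)`. Below `d₊` only the number of real roots of the cubic matters, which is decided by the
sign of `4 E ^ 3 - 27 B ^ 2`. Solving `4 E ^ 3 = 27 B ^ 2` for `d` gives, with `q = a (1 - a)`,
the closed form `18 d₋(a) = 1 - q - ((1 - 4 q) (2 + q) ^ 2 / 4) ^ (1 / 3)`.

Symmetry, smoothness and monotonicity are read off from this formula. Both expansions come from the
algebraic equation `(1 - q - 18 d₋) ^ 3 = (1 - 4 q) (2 + q) ^ 2 / 4`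
(`one_sub_sub_dMinusFn_pow_three`): near `a = 0` one compares cubes, and near `a = 1 / 2`, writing
`x = 1 / 2 - a` and `η = 1 / 24 - d₋`, the equation reads
`x ^ 2 (9 / 4 - x ^ 2) ^ 2 = (x ^ 2 + 18 η) ^ 3`, whose leading order is `x ^ 2 = 1152 η ^ 3`.
-/

/-! ### Real roots of a depressed cubic -/

/-- The real roots of the depressed cubic `t ^ 3 - E t + B`. -/
def depressedCubicRoots (E B : ℝ) : Set ℝ := {t | t ^ 3 - E * t + B = 0}

lemma mem_depressedCubicRoots {E B t : ℝ} :
    t ∈ depressedCubicRoots E B ↔ t ^ 3 - E * t + B = 0 := Iff.rfl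

lemma depressedCubicRoots_nonempty (E B : ℝ) : (depressedCubicRoots E B).Nonempty := by
  have hE := abs_nonneg E
  have hB := abs_nonneg B
  set M : ℝ := 1 + |E| + |B| with hM
  have hM1 : 1 ≤ M := by linarith
  have hcont : ContinuousOn (fun t : ℝ => t ^ 3 - E * t + B) (Icc (-M) M) := by fun_prop
  -- `M ^ 3` dominates `|E| M + |B|` because `M ≥ 1`.
  have hdom : |E| * M + |B| ≤ M ^ 3 := by
    have h1 : M ≤ M ^ 2 := by nlinarith
    have h2 : |E| * M + |B| ≤ M * M := by nlinarith
    nlinarith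
  have hEM := mul_le_mul_of_nonneg_right (le_abs_self E) (by linarith : (0 : ℝ) ≤ M)
  have hEM' := mul_le_mul_of_nonneg_right (neg_abs_le E) (by linarith : (0 : ℝ) ≤ M)
  have h0 : (0 : ℝ) ∈ Icc ((-M) ^ 3 - E * (-M) + B) (M ^ 3 - E * M + B) :=
    ⟨by nlinarith [le_abs_self B], by nlinarith [neg_abs_le B]⟩
  obtain ⟨t, -, ht⟩ := intermediate_value_Icc (by linarith : -M ≤ M) hcont h0
  exact ⟨t, ht⟩

/-- The discriminant `4 E ^ 3 - 27 B ^ 2` is a square as soon as there are two distinct real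
roots, so a negative discriminant leaves only one. -/
lemma encard_depressedCubicRoots_of_disc_neg {E B : ℝ} (h : 4 * E ^ 3 < 27 * B ^ 2) :
    (depressedCubicRoots E B).encard = 1 := by
  obtain ⟨t, ht⟩ := depressedCubicRoots_nonempty E B
  rw [encard_eq_one]
  refine ⟨t, eq_singleton_iff_unique_mem.2 ⟨ht, fun r hr => ?_⟩⟩
  by_contra hne
  rw [mem_depressedCubicRoots] at ht hr
  have hE : E = t ^ 2 + t * r + r ^ 2 := by
    apply mul_left_cancel₀ (sub_ne_zero.2 hne)
    linear_combination ht - hr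
  have hB : B = t * r * (t + r) := by
    subst hE
    linear_combination ht
  subst hE hB
  nlinarith [sq_nonneg ((t - r) * (2 * t + r) * (t + 2 * r))]

lemma encard_depressedCubicRoots_of_disc_pos {E B : ℝ} (h : 27 * B ^ 2 < 4 * E ^ 3) :
    (depressedCubicRoots E B).encard = 3 := by
  obtain ⟨t, ht⟩ := depressedCubicRoots_nonempty E B
  rw [mem_depressedCubicRoots] at ht
  -- The discriminant factors through the quadratic that remains after dividing by the root `t`.
  have hdisc : 4 * E ^ 3 - 27 * B ^ 2 = (4 * E - 3 * t ^ 2) * (E - 3 * t ^ 2) ^ 2 := by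
    have hB : B = E * t - t ^ 3 := by linear_combination ht
    subst hB
    ring
  have hprod : 0 < (4 * E - 3 * t ^ 2) * (E - 3 * t ^ 2) ^ 2 := by linarith
  have hpos : 0 < 4 * E - 3 * t ^ 2 := pos_of_mul_pos_left hprod (sq_nonneg _)
  have hne : E - 3 * t ^ 2 ≠ 0 := fun h0 => by simp [h0] at hprod
  set w := √(4 * E - 3 * t ^ 2) with hw
  have hw2 : w ^ 2 = 4 * E - 3 * t ^ 2 := Real.sq_sqrt hpos.le
  have hw0 : 0 < w := Real.sqrt_pos.2 hpos
  have hset : depressedCubicRoots E B = {t, (-t + w) / 2, (-t - w) / 2} := by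
    ext r
    have hfac : r ^ 3 - E * r + B = (r - t) * ((r - (-t + w) / 2) * (r - (-t - w) / 2)) := by
      linear_combination ht + (r - t) / 4 * hw2
    rw [mem_depressedCubicRoots, hfac]
    simp [mul_eq_zero, sub_eq_zero]
  have h1 : t ≠ (-t + w) / 2 := fun h1 => hne (by
    have : w = 3 * t := by linarith
    rw [this] at hw2
    linarith)
  have h2 : t ≠ (-t - w) / 2 := fun h2 => hne (by
    have : w = -(3 * t) := by linarith
    rw [this] at hw2
    linarith)
  have h3 : (-t + w) / 2 ≠ (-t - w) / 2 := fun h3 => by linarith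
  rw [hset, encard_eq_three]
  exact ⟨_, _, _, h1, h2, h3, rfl⟩

lemma encard_depressedCubicRoots_of_disc_eq_zero {E B : ℝ} (h : 4 * E ^ 3 = 27 * B ^ 2)
    (hB : B ≠ 0) : (depressedCubicRoots E B).encard = 2 := by
  have hE : E ≠ 0 := by
    rintro rfl
    apply hB
    have : B ^ 2 = 0 := by linarith
    simpa using this
  -- The double root `r` is determined by `E = 3 r ^ 2` and `B = 2 r ^ 3`.
  obtain ⟨r, hr⟩ : ∃ r, r = 3 * B / (2 * E) := ⟨_, rfl⟩
  have hrE : E * r = 3 * B / 2 := by rw [hr]; field_simp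
  have h1 : E = 3 * r ^ 2 := by
    apply mul_left_cancel₀ (pow_ne_zero 2 hE)
    have : (E * r) ^ 2 = (3 * B / 2) ^ 2 := by rw [hrE]
    linarith
  have h2 : B = 2 * r ^ 3 := by
    rw [h1] at hrE
    linarith
  have hr0 : r ≠ 0 := by
    rintro rfl
    simp at h2
    exact hB h2
  have hset : depressedCubicRoots E B = {r, -2 * r} := by
    ext t
    have hfac : t ^ 3 - E * t + B = (t - r) ^ 2 * (t - -2 * r) := by
      rw [h1, h2]; ring
    rw [mem_depressedCubicRoots, hfac]
    simp [mul_eq_zero, sub_eq_zero, add_eq_zero_iff_eq_neg]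
  rw [hset, encard_pair]
  intro h0
  apply hr0
  linarith

lemma encard_depressedCubicRoots_zero : (depressedCubicRoots 0 0).encard = 1 := by
  have : depressedCubicRoots 0 0 = {0} := by
    ext t
    simp [mem_depressedCubicRoots]
  rw [this, encard_singleton]

/-! ### Reduction of the system to the cubic -/

/-- The linear coefficient `E` of the cubic satisfied by `t = u + v - 2 (1 + a) / 3` at an
off-diagonal root `(u, v)`. -/
noncomputable def branchE (a d : ℝ) : ℝ := (1 - a + a ^ 2) / 3 - 6 * d

/-- The constant coefficient `B` of the cubic satisfied by `t = u + v - 2 (1 + a) / 3` at an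
off-diagonal root `(u, v)`. -/
noncomputable def branchB (a : ℝ) : ℝ := (1 - 2 * a) * (2 - a) * (1 + a) / 27

/-- The value of `(u - v) ^ 2` at an off-diagonal root `(u, v)` with
`t = u + v - 2 (1 + a) / 3`. -/
noncomputable def branchSq (a d t : ℝ) : ℝ := 4 * branchE a d + 8 * d - 3 * t ^ 2

lemma mem_bichromaticRoots_iff {a d u v : ℝ} :
    (u, v) ∈ bichromaticRoots a d ↔
      (u = v ∧ nagumoG u a = 0) ∨
      (u ≠ v ∧ u + v - 2 * (1 + a) / 3 ∈ depressedCubicRoots (branchE a d) (branchB a) ∧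
        (u - v) ^ 2 = branchSq a d (u + v - 2 * (1 + a) / 3)) := by
  simp only [bichromaticRoots, bichromaticG, nagumoG, mem_ofPred_eq, Prod.mk_eq_zero,
    mem_depressedCubicRoots, branchE, branchB, branchSq]
  constructor
  · rintro ⟨h1, h2⟩
    by_cases huv : u = v
    · subst huv
      exact Or.inl ⟨rfl, by linarith⟩
    · -- The difference of the two equations, divided by `v - u`.
      have hd : 4 * d = u * v - (u + v - 1) * (u + v - a) := by
        apply mul_left_cancel₀ (sub_ne_zero.2 huv)
        linear_combination h2 - h1
      refine Or.inr ⟨huv, ?_, ?_⟩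
      · linear_combination (h1 + h2) / 2 + (3 * (u + v) - 2 * (1 + a)) / 2 * hd
      · linear_combination 4 * hd
  · rintro (⟨rfl, h⟩ | ⟨-, h, hsq⟩)
    · exact ⟨by linarith, by linarith⟩
    · have hd : 4 * d = u * v - (u + v - 1) * (u + v - a) := by linear_combination hsq / 4
      constructor
      · linear_combination h - ((3 * (u + v) - 2 * (1 + a)) / 2 + (u - v) / 2) * hd
      · linear_combination h - ((3 * (u + v) - 2 * (1 + a)) / 2 - (u - v) / 2) * hd

/-- The elimination of `t` between the cubic and `branchSq a d t = 0`. With `y` the value of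
`t ^ 2` at which `branchSq` vanishes, both sides equal `36 (y (y - E) ^ 2 - B ^ 2)`; the factors
`4 d + a`, `4 d + 1 - a` and `4 d - a (1 - a)` are `4 d - g'(u; a)` at the three zeros
`u = 0, 1, a` of the nonlinearity. -/
lemma branchSq_mul_eq {a d t : ℝ} (ht : t ∈ depressedCubicRoots (branchE a d) (branchB a)) :
    3 * branchSq a d t *
      ((2 * t ^ 2 + (4 * branchE a d + 8 * d) / 3 - 2 * branchE a d) ^ 2
        + 8 * d * ((4 * branchE a d + 8 * d) / 3)) =
      -4 / 3 * ((4 * d + a) * (4 * d + 1 - a) * (4 * d - a * (1 - a))) := by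
  rw [mem_depressedCubicRoots] at ht
  have hB : branchB a ^ 2 = (branchE a d * t - t ^ 3) ^ 2 := by
    rw [show branchB a = branchE a d * t - t ^ 3 by linear_combination ht]
  simp only [branchSq, branchE, branchB] at hB ⊢
  linear_combination 36 * hB

lemma branchSq_pos {a d t : ℝ} (ha : a ∈ Ioo (0 : ℝ) 1) (hd : 0 ≤ d) (hd' : d < a * (1 - a) / 4)
    (ht : t ∈ depressedCubicRoots (branchE a d) (branchB a)) : 0 < branchSq a d t := by
  obtain ⟨h0, h1⟩ := ha
  by_contra! hneg
  have hkey := branchSq_mul_eq ht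
  have hy : 0 ≤ 4 * branchE a d + 8 * d := by
    simp only [branchE]
    nlinarith [sq_nonneg (1 - 2 * a)]
  have hrhs : 0 < (4 * d + a) * (4 * d + 1 - a) * (a * (1 - a) - 4 * d) :=
    mul_pos (mul_pos (by linarith) (by linarith)) (by linarith)
  have hN : 0 ≤ (2 * t ^ 2 + (4 * branchE a d + 8 * d) / 3 - 2 * branchE a d) ^ 2
        + 8 * d * ((4 * branchE a d + 8 * d) / 3) := by positivity
  have := mul_nonneg (neg_nonneg.2 hneg) hN
  linarith

lemma branchSq_nonpos {a d t : ℝ} (ha : a ∈ Ioo (0 : ℝ) 1) (hd : a * (1 - a) / 4 ≤ d)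
    (ht : t ∈ depressedCubicRoots (branchE a d) (branchB a)) : branchSq a d t ≤ 0 := by
  obtain ⟨h0, h1⟩ := ha
  by_contra! hpos
  have hkey := branchSq_mul_eq ht
  have hd0 : 0 < d := by nlinarith
  have hy : 0 < 4 * branchE a d + 8 * d := by
    have : branchSq a d t = 4 * branchE a d + 8 * d - 3 * t ^ 2 := rfl
    nlinarith [sq_nonneg t]
  have hrhs : 0 ≤ (4 * d + a) * (4 * d + 1 - a) * (4 * d - a * (1 - a)) :=
    mul_nonneg (mul_nonneg (by linarith) (by linarith)) (by linarith)
  have hN : 0 < (2 * t ^ 2 + (4 * branchE a d + 8 * d) / 3 - 2 * branchE a d) ^ 2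
        + 8 * d * ((4 * branchE a d + 8 * d) / 3) := by positivity
  have := mul_pos hpos hN
  linarith

/-! ### Counting the roots of the system -/

/-- The roots of the system on the diagonal. -/
def diagonalRoots (a : ℝ) : Set (ℝ × ℝ) := {(0, 0), (a, a), (1, 1)}

lemma mem_diagonalRoots_iff {a u v : ℝ} :
    (u, v) ∈ diagonalRoots a ↔ u = v ∧ nagumoG u a = 0 := by
  simp only [diagonalRoots, nagumoG, mem_insert_iff, mem_singleton_iff, Prod.mk.injEq,
    mul_eq_zero, sub_eq_zero]
  constructor
  · rintro (⟨rfl, rfl⟩ | ⟨rfl, rfl⟩ | ⟨rfl, rfl⟩) <;> simp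
  · rintro ⟨rfl, (h | h) | h⟩
    · simp [h]
    · simp [← h]
    · simp [h]

lemma encard_diagonalRoots {a : ℝ} (ha : a ∈ Ioo (0 : ℝ) 1) : (diagonalRoots a).encard = 3 := by
  rw [encard_eq_three]
  refine ⟨_, _, _, ?_, ?_, ?_, rfl⟩
  · simp [ha.1.ne]
  · simp
  · simp [ha.2.ne]

lemma encard_bichromaticRoots_of_le {a d : ℝ} (ha : a ∈ Ioo (0 : ℝ) 1)
    (hd : a * (1 - a) / 4 ≤ d) : (bichromaticRoots a d).encard = 3 := by
  rw [← encard_diagonalRoots ha]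
  congr 1
  ext ⟨u, v⟩
  rw [mem_bichromaticRoots_iff, mem_diagonalRoots_iff, or_iff_left]
  rintro ⟨huv, ht, hsq⟩
  have h1 : 0 < (u - v) ^ 2 := by
    have := sub_ne_zero.2 huv
    positivity
  have h2 := branchSq_nonpos ha hd ht
  linarith

/-- The off-diagonal root with `u + v - 2 (1 + a) / 3 = t` and `u - v = σ √(branchSq a d t)`,
where `σ` is a sign. -/
noncomputable def offDiagonalRoot (a d σ t : ℝ) : ℝ × ℝ :=
  ((t + 2 * (1 + a) / 3 + σ * √(branchSq a d t)) / 2,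
    (t + 2 * (1 + a) / 3 - σ * √(branchSq a d t)) / 2)

lemma offDiagonalRoot_injective (a d σ : ℝ) : Function.Injective (offDiagonalRoot a d σ) := by
  intro t t' h
  simp only [offDiagonalRoot, Prod.mk.injEq] at h
  linarith [h.1, h.2]

lemma encard_bichromaticRoots_of_lt {a d : ℝ} (ha : a ∈ Ioo (0 : ℝ) 1) (hd : 0 ≤ d)
    (hd' : d < a * (1 - a) / 4) :
    (bichromaticRoots a d).encard =
      3 + ((depressedCubicRoots (branchE a d) (branchB a)).encard
        + (depressedCubicRoots (branchE a d) (branchB a)).encard) := by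
  set S := depressedCubicRoots (branchE a d) (branchB a) with hS
  have hset : bichromaticRoots a d =
      diagonalRoots a ∪ (offDiagonalRoot a d 1 '' S ∪ offDiagonalRoot a d (-1) '' S) := by
    ext ⟨u, v⟩
    rw [mem_bichromaticRoots_iff, mem_union, mem_diagonalRoots_iff]
    refine or_congr Iff.rfl ⟨?_, ?_⟩
    · rintro ⟨huv, ht, hsq⟩
      rcases lt_or_gt_of_ne huv with hlt | hlt
      · refine Or.inr ⟨_, ht, ?_⟩
        rw [offDiagonalRoot, ← hsq, Real.sqrt_sq_eq_abs, abs_of_neg (by linarith)]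
        ext <;> simp
      · refine Or.inl ⟨_, ht, ?_⟩
        rw [offDiagonalRoot, ← hsq, Real.sqrt_sq_eq_abs, abs_of_pos (by linarith)]
        ext <;> simp
    · rintro (⟨t, ht, h⟩ | ⟨t, ht, h⟩) <;>
      · have hpos := branchSq_pos ha hd hd' ht
        have hw := Real.sqrt_pos.2 hpos
        have hw2 := Real.sq_sqrt hpos.le
        simp only [offDiagonalRoot, Prod.mk.injEq] at h
        obtain ⟨rfl, rfl⟩ := h
        refine ⟨fun h => by linarith, ?_, ?_⟩
        · convert ht using 1
          ring
        · ring_nf at hw2 ⊢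
          rw [hw2]
  have hdisj : Disjoint (offDiagonalRoot a d 1 '' S) (offDiagonalRoot a d (-1) '' S) := by
    rw [Set.disjoint_left]
    rintro _ ⟨t, ht, rfl⟩ ⟨t', ht', h⟩
    have h1 := Real.sqrt_pos.2 (branchSq_pos ha hd hd' ht)
    have h2 := Real.sqrt_pos.2 (branchSq_pos ha hd hd' ht')
    simp only [offDiagonalRoot, Prod.mk.injEq] at h
    linarith [h.1, h.2]
  have hdisj' : Disjoint (diagonalRoots a)
      (offDiagonalRoot a d 1 '' S ∪ offDiagonalRoot a d (-1) '' S) := by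
    rw [Set.disjoint_left]
    rintro ⟨u, v⟩ huv h
    have huv' := (mem_diagonalRoots_iff.1 huv).1
    rcases h with ⟨t, ht, h⟩ | ⟨t, ht, h⟩ <;>
    · have h1 := Real.sqrt_pos.2 (branchSq_pos ha hd hd' ht)
      simp only [offDiagonalRoot, Prod.mk.injEq] at h
      linarith [h.1, h.2]
  rw [hset, encard_union_eq hdisj', encard_union_eq hdisj, encard_diagonalRoots ha,
    (offDiagonalRoot_injective a d 1).encard_image,
    (offDiagonalRoot_injective a d (-1)).encard_image]

/-! ### The fold curve -/

/-- `K = (1 - 4 q) (2 + q) ^ 2 / 4` with `q = a (1 - a)`, a multiple of `B ^ 2`. -/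
noncomputable def foldCube (a : ℝ) : ℝ := (1 - 4 * (a * (1 - a))) * (2 + a * (1 - a)) ^ 2 / 4

/-- The value `d₋(a)` of `d` at which the cubic has a multiple root. -/
noncomputable def dMinusFn (a : ℝ) : ℝ := (1 - a * (1 - a) - foldCube a ^ (1 / 3 : ℝ)) / 18

lemma foldCube_eq (a : ℝ) : foldCube a = ((1 - 2 * a) * (2 + a * (1 - a)) / 2) ^ 2 := by
  simp only [foldCube]
  ring

lemma foldCube_nonneg (a : ℝ) : 0 ≤ foldCube a := by
  rw [foldCube_eq]
  positivity

lemma one_sub_sub_dMinusFn_nonneg (a : ℝ) : 0 ≤ 1 - a * (1 - a) - 18 * dMinusFn a := by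
  have := Real.rpow_nonneg (foldCube_nonneg a) (1 / 3)
  simp only [dMinusFn]
  linarith

lemma one_sub_sub_dMinusFn_pow_three (a : ℝ) :
    (1 - a * (1 - a) - 18 * dMinusFn a) ^ 3 = foldCube a := by
  have h : 1 - a * (1 - a) - 18 * dMinusFn a = foldCube a ^ (1 / 3 : ℝ) := by
    simp only [dMinusFn]
    ring
  rw [h, ← Real.rpow_natCast, ← Real.rpow_mul (foldCube_nonneg a)]
  norm_num

/-- The discriminant of the cubic, as a difference of two cubes. -/
lemma disc_branch_eq (a d : ℝ) :
    4 * branchE a d ^ 3 - 27 * branchB a ^ 2 =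
      4 / 27 * ((1 - a * (1 - a) - 18 * d) ^ 3 - (1 - a * (1 - a) - 18 * dMinusFn a) ^ 3) := by
  rw [one_sub_sub_dMinusFn_pow_three]
  simp only [branchE, branchB, foldCube]
  ring

lemma disc_branch_pos_iff {a d : ℝ} :
    27 * branchB a ^ 2 < 4 * branchE a d ^ 3 ↔ d < dMinusFn a := by
  have h := disc_branch_eq a d
  have hmono : StrictMono fun x : ℝ => x ^ 3 := Odd.strictMono_pow (by decide)
  have h' := hmono.lt_iff_lt (a := 1 - a * (1 - a) - 18 * dMinusFn a)
    (b := 1 - a * (1 - a) - 18 * d)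
  constructor
  · intro hlt
    have := h'.1 (by linarith)
    linarith
  · intro hlt
    have := h'.2 (by linarith)
    linarith

lemma disc_branch_neg_iff {a d : ℝ} :
    4 * branchE a d ^ 3 < 27 * branchB a ^ 2 ↔ dMinusFn a < d := by
  have h := disc_branch_eq a d
  have hmono : StrictMono fun x : ℝ => x ^ 3 := Odd.strictMono_pow (by decide)
  have h' := hmono.lt_iff_lt (b := 1 - a * (1 - a) - 18 * dMinusFn a)
    (a := 1 - a * (1 - a) - 18 * d)
  constructor
  · intro hlt
    have := h'.1 (by linarith)
    linarith
  · intro hlt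
    have := h'.2 (by linarith)
    linarith

lemma dMinusFn_one_sub (a : ℝ) : dMinusFn (1 - a) = dMinusFn a := by
  have h : (1 - a) * (1 - (1 - a)) = a * (1 - a) := by ring
  simp only [dMinusFn, foldCube, h]

lemma dMinusFn_zero : dMinusFn 0 = 0 := by
  norm_num [dMinusFn, foldCube]

lemma dMinusFn_one : dMinusFn 1 = 0 := by
  norm_num [dMinusFn, foldCube]

lemma dMinusFn_half : dMinusFn (1 / 2) = 1 / 24 := by
  norm_num [dMinusFn, foldCube]

lemma dMinusFn_lt_dPlus {a : ℝ} (ha : a ∈ Ioo (0 : ℝ) 1) : dMinusFn a < a * (1 - a) / 4 := by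
  rw [← disc_branch_neg_iff]
  obtain ⟨h0, h1⟩ := ha
  have hq : 0 < a * (1 - a) := mul_pos h0 (by linarith)
  have hq4 : a * (1 - a) ≤ 1 / 4 := by nlinarith [sq_nonneg (1 - 2 * a)]
  -- At `d = q / 4` with `q = a (1 - a)` the discriminant is `-q (2 - 7 q) ^ 2 / 2`.
  have hpos : 0 < a * (1 - a) * (2 - 7 * (a * (1 - a))) ^ 2 := by
    have : 0 < 2 - 7 * (a * (1 - a)) := by linarith
    positivity
  simp only [branchE, branchB]
  linear_combination hpos / 2

lemma continuous_dMinusFn : Continuous dMinusFn := by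
  unfold dMinusFn foldCube
  refine ((by fun_prop : Continuous fun a : ℝ => 1 - a * (1 - a)).sub ?_).div_const _
  exact (by fun_prop : Continuous fun a : ℝ =>
    (1 - 4 * (a * (1 - a))) * (2 + a * (1 - a)) ^ 2 / 4).rpow_const fun _ => Or.inr (by norm_num)

lemma contDiffOn_dMinusFn {s : Set ℝ} (hs : s ⊆ Icc 0 1) (hs' : (1 / 2 : ℝ) ∉ s) :
    ContDiffOn ℝ ∞ dMinusFn s := by
  have hK : ContDiff ℝ ∞ foldCube := by
    unfold foldCube
    fun_prop
  refine (ContDiffOn.sub (by fun_prop) (hK.contDiffOn.rpow_const_of_ne fun a ha => ?_)).div_const _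
  rw [foldCube_eq]
  have h1 : 1 - 2 * a ≠ 0 := fun h => hs' (by
    have : a = 1 / 2 := by linarith
    exact this ▸ ha)
  have h2 : 0 < 2 + a * (1 - a) := by nlinarith [(hs ha).1, (hs ha).2]
  have h3 := h2.ne'
  positivity

/-- Strict monotonicity of `d₋` as a function of `q = a (1 - a)`: the polynomial `K` decreases in
`q > 0` with slope below `-3`, while the slope of `c ↦ c ^ 3` is at most `3` on `[0, 1]`. -/
lemma dMinusFn_lt_of_mul_lt {a b : ℝ} (ha : 0 ≤ a * (1 - a)) (hab : a * (1 - a) < b * (1 - b)) :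
    dMinusFn a < dMinusFn b := by
  have ha3 := one_sub_sub_dMinusFn_pow_three a
  have hb3 := one_sub_sub_dMinusFn_pow_three b
  have ha0 := one_sub_sub_dMinusFn_nonneg a
  have hb0 := one_sub_sub_dMinusFn_nonneg b
  have hq4 : b * (1 - b) ≤ 1 / 4 := by nlinarith [sq_nonneg (1 - 2 * b)]
  simp only [foldCube] at ha3 hb3
  generalize b * (1 - b) = r at *
  generalize a * (1 - a) = q at *
  generalize hx : 1 - q - 18 * dMinusFn a = x at *
  generalize hy : 1 - r - 18 * dMinusFn b = y at *
  by_contra! hle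
  have hxy : x ≤ y + (r - q) := by linarith
  have hy1 : y ≤ 1 - r := by
    refine le_of_pow_le_pow_left₀ (n := 3) (by norm_num) (by linarith) ?_
    rw [hb3]
    nlinarith [sq_nonneg r]
  have h1 : x ^ 3 ≤ (y + (r - q)) ^ 3 := pow_le_pow_left₀ ha0 hxy 3
  have h2 : (y + (r - q)) ^ 3 - y ^ 3 ≤ 3 * (r - q) := by
    have h3 : (y + (r - q)) ^ 3 - y ^ 3 =
      (r - q) * (3 * (y + (r - q)) ^ 2 - (r - q) * (3 * y + 2 * (r - q))) := by ring
    have h4 : (y + (r - q)) ^ 2 ≤ 1 := by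
      apply pow_le_one₀ <;> linarith
    have h5 : 0 ≤ (r - q) * (3 * y + 2 * (r - q)) := mul_nonneg (by linarith) (by linarith)
    rw [h3]
    nlinarith
  have h6 : x ^ 3 - y ^ 3 = (r - q) * (3 + 15 / 4 * (q + r) + (q ^ 2 + q * r + r ^ 2)) := by
    rw [ha3, hb3]
    ring
  have h7 : 0 < (r - q) * (15 / 4 * (q + r) + (q ^ 2 + q * r + r ^ 2)) := by
    have : 0 < r - q := by linarith
    have : 0 < r := by linarith
    positivity
  linarith

lemma strictMonoOn_dMinusFn : StrictMonoOn dMinusFn (Icc 0 (1 / 2)) := by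
  intro a ha b hb hab
  exact dMinusFn_lt_of_mul_lt (by nlinarith [ha.1, ha.2]) (by nlinarith [ha.1, hb.2])

lemma strictAntiOn_dMinusFn : StrictAntiOn dMinusFn (Icc (1 / 2) 1) := by
  intro a ha b hb hab
  exact dMinusFn_lt_of_mul_lt (by nlinarith [hb.1, hb.2]) (by nlinarith [ha.1, hb.2])

lemma dMinusFn_pos {a : ℝ} (ha : a ∈ Ioo (0 : ℝ) 1) : 0 < dMinusFn a := by
  rw [← dMinusFn_zero]
  exact dMinusFn_lt_of_mul_lt (by norm_num) (by nlinarith [ha.1, ha.2])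

lemma dMinusFn_nonneg {a : ℝ} (ha : a ∈ Icc (0 : ℝ) 1) : 0 ≤ dMinusFn a := by
  rcases eq_or_lt_of_le ha.1 with rfl | h0
  · rw [dMinusFn_zero]
  rcases eq_or_lt_of_le ha.2 with rfl | h1
  · rw [dMinusFn_one]
  exact (dMinusFn_pos ⟨h0, h1⟩).le

/-! ### Expansions at the two ends of the fold curve -/

lemma dMinusFn_expansion_zero :
    (fun a : ℝ => dMinusFn a - (a ^ 2 / 8 + a ^ 4 / 32)) =O[𝓝[>] 0] (fun a : ℝ => a ^ 5) := by
  refine IsBigO.of_bound 100 ?_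
  filter_upwards [Ioo_mem_nhdsGT (by norm_num : (0 : ℝ) < 1 / 4)] with a ha
  obtain ⟨h0, h1⟩ := ha
  have h3 := one_sub_sub_dMinusFn_pow_three a
  have hx0 := one_sub_sub_dMinusFn_nonneg a
  simp only [foldCube] at h3
  set x := 1 - a * (1 - a) - 18 * dMinusFn a with hx
  -- `y` is the approximation of the cube root `x` given by the truncated expansion of `d₋`.
  obtain ⟨y, hy⟩ : ∃ y, y = 1 - a - 5 / 4 * a ^ 2 - 9 / 16 * a ^ 4 := ⟨_, rfl⟩
  have ha2 : a ^ 2 ≤ 1 / 16 := by nlinarith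
  have ha4 : a ^ 4 ≤ 1 / 256 := by nlinarith [sq_nonneg a]
  have hy1 : 1 / 2 ≤ y := by rw [hy]; linarith
  have hden : 1 / 4 ≤ x ^ 2 + x * y + y ^ 2 := by nlinarith [mul_nonneg hx0 (by linarith : 0 ≤ y)]
  have hdiff : dMinusFn a - (a ^ 2 / 8 + a ^ 4 / 32) = (y - x) / 18 := by rw [hx, hy]; ring
  -- The expansions of `x ^ 3` and `y ^ 3` in `a` agree through order four.
  have hcube : |x ^ 3 - y ^ 3| ≤ 100 * a ^ 5 := by
    have hW : x ^ 3 - y ^ 3 = a ^ 5 * (-27 / 16 + 27 / 64 * a + 135 / 32 * a ^ 2 + 27 / 16 * a ^ 3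
        + 243 / 256 * a ^ 4 + 1215 / 1024 * a ^ 5 + 729 / 4096 * a ^ 7) := by
      rw [h3, hy]
      ring
    have hk : ∀ k : ℕ, 0 ≤ a ^ k ∧ a ^ k ≤ 1 := fun k =>
      ⟨by positivity, pow_le_one₀ h0.le (by linarith)⟩
    rw [hW, abs_mul, abs_of_pos (by positivity : 0 < a ^ 5), mul_comm]
    refine mul_le_mul_of_nonneg_right (abs_le.2 ⟨?_, ?_⟩) (hk 5).1 <;>
      linarith [(hk 2).1, (hk 3).1, (hk 4).1, (hk 5).1, (hk 7).1,
        (hk 2).2, (hk 3).2, (hk 4).2, (hk 5).2, (hk 7).2]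
  have hprod : |x ^ 3 - y ^ 3| = |y - x| * (x ^ 2 + x * y + y ^ 2) := by
    rw [abs_sub_comm y x, show x ^ 3 - y ^ 3 = (x - y) * (x ^ 2 + x * y + y ^ 2) by ring, abs_mul,
      abs_of_nonneg (by linarith : 0 ≤ x ^ 2 + x * y + y ^ 2)]
  rw [Real.norm_eq_abs, Real.norm_eq_abs, abs_of_pos (by positivity : 0 < a ^ 5), hdiff, abs_div,
    abs_of_pos (by norm_num : (0 : ℝ) < 18)]
  have h5 : 0 < a ^ 5 := by positivity
  nlinarith [abs_nonneg (y - x)]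

/-- A quantitative form of `1 / 2 - a ≈ √(1152 η ^ 3)` for `η = 1 / 24 - d₋(a)`; the constant is not
optimized. -/
lemma abs_sub_sqrt_le {a η : ℝ} (ha : a ∈ Icc (0 : ℝ) (1 / 2)) (hη : 0 < η) (hη1 : η < 1 / 24)
    (hd : dMinusFn a = 1 / 24 - η) :
    |(1 / 2 - a) - √(1152 * η ^ 3)| ≤ 100000000 * η ^ 2 := by
  obtain ⟨h0, h1⟩ := ha
  have h3 := one_sub_sub_dMinusFn_pow_three a
  simp only [foldCube, hd] at h3
  obtain ⟨x, rfl⟩ : ∃ x, a = 1 / 2 - x := ⟨1 / 2 - a, by ring⟩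
  have hx0 : 0 ≤ x := by linarith
  have hx1 : x ≤ 1 / 2 := by linarith
  have hkey : x ^ 2 * (9 / 4 - x ^ 2) ^ 2 = (x ^ 2 + 18 * η) ^ 3 := by
    linear_combination -h3
  obtain ⟨y, hy⟩ : ∃ y, y = x ^ 2 := ⟨_, rfl⟩
  rw [← hy] at hkey
  have hy0 : 0 ≤ y := by rw [hy]; positivity
  have hy1 : y ≤ 1 / 4 := by rw [hy]; nlinarith
  -- A first rough bound on `y`, from `(9 / 4 - y) ^ 2 ≥ 4` and convexity of the cube.
  have hrough : y ≤ 7000 * η ^ 3 := by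
    have e1 : 4 * y ≤ y * (9 / 4 - y) ^ 2 := by
      have : 4 ≤ (9 / 4 - y) ^ 2 := by nlinarith
      nlinarith
    have e2 : (y + 18 * η) ^ 3 ≤ 4 * (y ^ 3 + (18 * η) ^ 3) := by
      nlinarith [mul_nonneg (by positivity : 0 ≤ y + 18 * η) (sq_nonneg (y - 18 * η))]
    have e3 : y ^ 3 ≤ y / 16 := by nlinarith [mul_nonneg hy0 (sq_nonneg y)]
    have : 0 < η ^ 3 := by positivity
    nlinarith
  have hη5 : 0 < η ^ 5 := by positivity
  -- The correction to the leading balance `81 / 16 * y = (18 * η) ^ 3` is of order `η ^ 5`.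
  have hfine : |y - 1152 * η ^ 3| ≤ 100000000 * η ^ 5 := by
    have e0 : y - 1152 * η ^ 3 = 16 / 81 * (9 / 2 * y ^ 2 + 54 * (y ^ 2 * η) + 972 * (y * η ^ 2)) := by
      linear_combination 16 / 81 * hkey
    have e1 : y ^ 2 ≤ 49000000 / 24 * η ^ 5 := by
      have : y ^ 2 ≤ (7000 * η ^ 3) ^ 2 := pow_le_pow_left₀ hy0 hrough 2
      nlinarith
    have e2 : y ^ 2 * η ≤ y ^ 2 := mul_le_of_le_one_right (sq_nonneg y) (by linarith)
    have e3 : y * η ^ 2 ≤ 7000 * η ^ 3 * η ^ 2 :=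
      mul_le_mul_of_nonneg_right hrough (sq_nonneg η)
    rw [e0, abs_of_nonneg (by positivity)]
    linarith
  obtain ⟨r, hr⟩ : ∃ r, r = √(1152 * η ^ 3) := ⟨_, rfl⟩
  have hr2 : r ^ 2 = 1152 * η ^ 3 := by rw [hr]; exact Real.sq_sqrt (by positivity)
  have hr0 : 0 ≤ r := by rw [hr]; positivity
  -- Dividing by `x + r` costs only a factor `η ^ (-2)`.
  have hrη : η ^ 2 ≤ r := by
    refine le_of_pow_le_pow_left₀ (n := 2) (by norm_num) hr0 ?_
    rw [hr2]
    have : 0 < η ^ 3 := by positivity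
    nlinarith
  rw [show 1 / 2 - (1 / 2 - x) = x by ring, ← hr]
  have hfac : |y - 1152 * η ^ 3| = |x - r| * (x + r) := by
    rw [← hr2, hy, sq_sub_sq, abs_mul, abs_of_nonneg (by linarith : 0 ≤ x + r), mul_comm]
  have hη2 : 0 < η ^ 2 := by positivity
  have hle : |x - r| * η ^ 2 ≤ 100000000 * η ^ 2 * η ^ 2 := by
    have e1 : |x - r| * η ^ 2 ≤ |x - r| * (x + r) :=
      mul_le_mul_of_nonneg_left (by linarith) (abs_nonneg _)
    have e2 : η ^ 5 ≤ η ^ 2 * η ^ 2 := by nlinarith [pow_pos hη 4]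
    linarith
  exact le_of_mul_le_mul_right hle hη2

lemma surjOn_dMinusFn : SurjOn dMinusFn (Icc 0 (1 / 2)) (Icc 0 (1 / 24)) := by
  have := intermediate_value_Icc (by norm_num : (0 : ℝ) ≤ 1 / 2) continuous_dMinusFn.continuousOn
  rwa [dMinusFn_zero, dMinusFn_half] at this

lemma mapsTo_dMinusFn : MapsTo dMinusFn (Icc 0 (1 / 2)) (Icc 0 (1 / 24)) := by
  have := strictMonoOn_dMinusFn.monotoneOn.mapsTo_Icc
  rwa [dMinusFn_zero, dMinusFn_half] at this

/-! ### The bifurcation diagram -/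

theorem mainTheorem3 :
    ∃ dPlus dMinus : ℝ → ℝ,
      -- two continuous functions `[0,1] → [0,∞)`
      (ContinuousOn dPlus (Icc 0 1) ∧ ContinuousOn dMinus (Icc 0 1) ∧
        MapsTo dPlus (Icc 0 1) (Ici 0) ∧ MapsTo dMinus (Icc 0 1) (Ici 0)) ∧
      -- (i) explicit expression, symmetry, ordering, special values
      ((∀ a ∈ Ioo (0 : ℝ) 1,
          dPlus a = deriv (fun u => nagumoG u a) a / 4 ∧
          dMinus a = dMinus (1 - a) ∧
          dPlus a = dPlus (1 - a) ∧
          dMinus a < dPlus a) ∧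
        dMinus 0 = 0 ∧ dPlus 0 = 0 ∧ dMinus 1 = 0 ∧ dPlus 1 = 0 ∧
        dMinus (1 / 2) = 1 / 24) ∧
      -- (ii) smoothness and strict monotonicity
      (ContDiffOn ℝ ∞ dMinus (Ico 0 (1 / 2)) ∧
        ContDiffOn ℝ ∞ dMinus (Ioc (1 / 2) 1) ∧
        StrictMonoOn dMinus (Icc 0 (1 / 2)) ∧
        StrictAntiOn dMinus (Icc (1 / 2) 1)) ∧
      -- (iii) number of distinct roots away from `d = d_-(a)`
      (∀ a ∈ Ioo (0 : ℝ) 1,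
        (∀ d : ℝ, 0 ≤ d → d < dMinus a → (bichromaticRoots a d).encard = 9) ∧
        (∀ d : ℝ, dMinus a < d → d < dPlus a → (bichromaticRoots a d).encard = 5) ∧
        (∀ d : ℝ, dPlus a ≤ d → (bichromaticRoots a d).encard = 3)) ∧
      -- (iv) number of distinct roots at `d = d_-(a)`
      ((∀ a ∈ Ioo (0 : ℝ) 1, a ≠ 1 / 2 →
          (bichromaticRoots a (dMinus a)).encard = 7) ∧
        (bichromaticRoots (1 / 2) (dMinus (1 / 2))).encard = 5) ∧
      -- (v) expansions of `d_-` and of the inverse `a_-` of `d_-` on `[0, 1/2]`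
      ((fun a : ℝ => dMinus a - (a ^ 2 / 8 + a ^ 4 / 32)) =O[𝓝[>] 0] (fun a : ℝ => a ^ 5) ∧
        ∃ aMinus : ℝ → ℝ,
          MapsTo dMinus (Icc 0 (1 / 2)) (Icc 0 (1 / 24)) ∧
          MapsTo aMinus (Icc 0 (1 / 24)) (Icc 0 (1 / 2)) ∧
          InvOn aMinus dMinus (Icc 0 (1 / 2)) (Icc 0 (1 / 24)) ∧
          (fun d : ℝ => aMinus d - (1 / 2 - √(-1152 * (d - 1 / 24) ^ 3)))
            =O[𝓝[<] (1 / 24)] (fun d : ℝ => (d - 1 / 24) ^ 2)) := by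

  refine ⟨fun a => a * (1 - a) / 4, dMinusFn,
    ⟨by fun_prop, continuous_dMinusFn.continuousOn, ?_, fun a ha => dMinusFn_nonneg ha⟩,
    ⟨?_, dMinusFn_zero, by norm_num, dMinusFn_one, by norm_num, dMinusFn_half⟩,
    ⟨contDiffOn_dMinusFn ?_ ?_, contDiffOn_dMinusFn ?_ ?_, strictMonoOn_dMinusFn,
      strictAntiOn_dMinusFn⟩, ?_, ⟨?_, ?_⟩, dMinusFn_expansion_zero, ?_⟩
  · intro a ha
    have := mul_nonneg ha.1 (sub_nonneg.2 ha.2)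
    simp only [mem_Ici]
    linarith
  · intro a ha
    refine ⟨?_, (dMinusFn_one_sub a).symm, by ring, dMinusFn_lt_dPlus ha⟩
    have h : HasDerivAt (fun u : ℝ => nagumoG u a)
        ((1 * (1 - a) + a * (0 - 1)) * (a - a) + a * (1 - a) * (1 - 0)) a :=
      ((hasDerivAt_id a).mul ((hasDerivAt_const a 1).sub (hasDerivAt_id a))).mul
        ((hasDerivAt_id a).sub (hasDerivAt_const a a))
    rw [h.deriv]
    ring
  · exact fun a ha => ⟨ha.1, by linarith [ha.2]⟩
  · simp
  · exact fun a ha => ⟨by linarith [ha.1], ha.2⟩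
  · simp
  · intro a ha
    refine ⟨fun d hd hlt => ?_, fun d hlt hlt' => ?_, fun d hle =>
      encard_bichromaticRoots_of_le ha hle⟩
    · rw [encard_bichromaticRoots_of_lt ha hd (hlt.trans (dMinusFn_lt_dPlus ha)),
        encard_depressedCubicRoots_of_disc_pos (disc_branch_pos_iff.2 hlt)]
      norm_num
    · rw [encard_bichromaticRoots_of_lt ha ((dMinusFn_pos ha).le.trans hlt.le) hlt',
        encard_depressedCubicRoots_of_disc_neg (disc_branch_neg_iff.2 hlt)]
      norm_num
  · intro a ha ha'
    have hB : branchB a ≠ 0 := by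
      have h1 : 1 - 2 * a ≠ 0 := fun h => ha' (by linarith)
      have h2 : 2 - a ≠ 0 := by linarith [ha.2]
      have h3 : 1 + a ≠ 0 := by linarith [ha.1]
      simp [branchB, h1, h2, h3]
    have hdisc : 4 * branchE a (dMinusFn a) ^ 3 = 27 * branchB a ^ 2 := by
      have := disc_branch_eq a (dMinusFn a)
      linarith
    rw [encard_bichromaticRoots_of_lt ha (dMinusFn_pos ha).le (dMinusFn_lt_dPlus ha),
      encard_depressedCubicRoots_of_disc_eq_zero hdisc hB]
    norm_num
  · have ha : (1 / 2 : ℝ) ∈ Ioo (0 : ℝ) 1 := by norm_num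
    have hE : branchE (1 / 2) (dMinusFn (1 / 2)) = 0 := by
      norm_num [branchE, dMinusFn_half]
    have hB : branchB (1 / 2) = 0 := by norm_num [branchB]
    rw [encard_bichromaticRoots_of_lt ha (dMinusFn_pos ha).le (dMinusFn_lt_dPlus ha), hE, hB,
      encard_depressedCubicRoots_zero]
    norm_num
  · have hbij : BijOn dMinusFn (Icc 0 (1 / 2)) (Icc 0 (1 / 24)) :=
      ⟨mapsTo_dMinusFn, strictMonoOn_dMinusFn.injOn, surjOn_dMinusFn⟩
    have hinv := hbij.invOn_invFunOn
    have hmaps := surjOn_dMinusFn.mapsTo_invFunOn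
    refine ⟨Function.invFunOn dMinusFn (Icc 0 (1 / 2)), mapsTo_dMinusFn, hmaps, hinv, ?_⟩
    refine IsBigO.of_bound 100000000 ?_
    filter_upwards [Ioo_mem_nhdsLT (by norm_num : (0 : ℝ) < 1 / 24)] with d hd
    have hd' : d ∈ Icc (0 : ℝ) (1 / 24) := Ioo_subset_Icc_self hd
    have h := abs_sub_sqrt_le (η := 1 / 24 - d) (hmaps hd') (by linarith [hd.2])
      (by linarith [hd.1]) (by rw [hinv.2 hd']; ring)
    rw [Real.norm_eq_abs, Real.norm_eq_abs, abs_of_nonneg (sq_nonneg (d - 1 / 24)),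
      show (d - 1 / 24) ^ 2 = (1 / 24 - d) ^ 2 by ring,
      show -1152 * (d - 1 / 24) ^ 3 = 1152 * (1 / 24 - d) ^ 3 by ring, ← abs_neg]
    refine le_of_eq_of_le ?_ h
    congr 1
    ring
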